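/- For $n\ge 1$ let $\mathcal S_0^n$ be the set of symmetric matrices in $\mathbb R^{n\times n}$ with zero diagonal. For $J\in\mathcal S_0^n$ let $\Pr_J$ be the Ising model with interaction matrix $J$ and no external field, i.e. the probability measure on $\{-1,1\}^n$ with $$\Pr_J[x]=\frac{\exp\left(\tfrac12 x^\top Jx\right)}{\sum_{y\in\{-1,1\}^n}\exp\left(\tfrac12 y^\top Jy\right)},$$ and let $\mathbf E_J$ denote expectation over $X\sim\Pr_J$. For $\gamma,C>0$ and $J^*\in\mathcal S_0^n$, say that $\Pr_{J^*}$ satisfies $(\gamma,C)$-regularity if for every $J\in\mathcal S_0^n$ with $\mathbf E_{J^*}\left[\|(J-J^*)X\|_2^2\right]\le\gamma$ one has $$\mathbf E_{J}\left[\|(J-J^*)X\|_2^2\right]\le C\cdot\mathbf E_{J^*}\left[\|(J-J^*)X\|_2^2\right].$$ **Theorem.** For every $\beta>1$ there exist constants $c_1,c_2>0$, depending only on $\beta$, such that for every $n\ge1$ the Curie–Weiss model with interaction matrix $J^*=\frac{\beta}{n}(\mathbf 1\mathbf 1^\top-I)\in\mathcal S_0^n$, where $\mathbf 1\in\mathbb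 R^n$ is the all-ones vector, satisfies $(c_1/n,c_2)$-regularity. -/

import Mathlib

open scoped Matrix BigOperators

/-- The set `𝒮₀ⁿ` of real symmetric `n × n` matrices with zero diagonal. -/
def zeroDiagSymm (n : ℕ) : Set (Matrix (Fin n) (Fin n) ℝ) :=
  {A | A.IsSymm ∧ ∀ i, A i i = 0}

/-- Spin configurations `x ∈ {-1, 1}ⁿ`; the units of `ℤ` are exactly `1` and `-1`. -/
abbrev SpinConfig (n : ℕ) : Type := Fin n → ℤˣ

/-- A spin configuration as a real vector with entries `±1`. -/
def SpinConfig.toVec {n : ℕ} (x : SpinConfig n) : Fin n → ℝ :=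
  fun i => ((x i : ℤ) : ℝ)

/-- The unnormalised weight `exp (xᵀ J x / 2)` (zero external field). -/
noncomputable def isingWeight {n : ℕ} (J : Matrix (Fin n) (Fin n) ℝ) (x : SpinConfig n) : ℝ :=
  Real.exp ((1 / 2 : ℝ) * (x.toVec ⬝ᵥ (J *ᵥ x.toVec)))

/-- The partition function `Z_J`, the sum of all weights. -/
noncomputable def isingPartition {n : ℕ} (J : Matrix (Fin n) (Fin n) ℝ) : ℝ :=
  ∑ x : SpinConfig n, isingWeight J x

/-- The probability mass `Pr_J[x]` of the Ising model with interaction matrix `J` and zero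
external field. -/
noncomputable def isingProb {n : ℕ} (J : Matrix (Fin n) (Fin n) ℝ) (x : SpinConfig n) : ℝ :=
  isingWeight J x / isingPartition J

/-- The expectation `E_J[f(X)]` for `X ∼ Pr_J`. -/
noncomputable def isingExpectation {n : ℕ} (J : Matrix (Fin n) (Fin n) ℝ)
    (f : SpinConfig n → ℝ) : ℝ :=
  ∑ x : SpinConfig n, isingProb J x * f x

/-- The squared Euclidean norm `‖A x‖₂²` at a spin configuration `x`. -/
noncomputable def sqNormMulSpin {n : ℕ} (A : Matrix (Fin n) (Fin n) ℝ) (x : SpinConfig n) : ℝ :=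
  ‖WithLp.toLp 2 (A *ᵥ x.toVec)‖ ^ 2

/-- `(γ, C)`-regularity (`γ, C > 0`) of the Ising model `Pr_{J*}`: for every `J ∈ 𝒮₀ⁿ` with
`E_{J*} ‖(J - J*) X‖₂² ≤ γ` one has
`E_J ‖(J - J*) X‖₂² ≤ C · E_{J*} ‖(J - J*) X‖₂²`. -/
def IsingRegular {n : ℕ} (Jstar : Matrix (Fin n) (Fin n) ℝ) (γ C : ℝ) : Prop :=
  0 < γ ∧ 0 < C ∧
    ∀ J ∈ zeroDiagSymm n,
      isingExpectation Jstar (sqNormMulSpin (J - Jstar)) ≤ γ →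
        isingExpectation J (sqNormMulSpin (J - Jstar)) ≤
          C * isingExpectation Jstar (sqNormMulSpin (J - Jstar))

/-- The Curie–Weiss interaction matrix `(β / n) (𝟙𝟙ᵀ - I)`. -/
noncomputable def curieWeiss (n : ℕ) (β : ℝ) : Matrix (Fin n) (Fin n) ℝ :=
  (β / n) • (Matrix.of (fun _ _ => (1 : ℝ)) - 1)

theorem isingPartition_pos {n : ℕ} (J : Matrix (Fin n) (Fin n) ℝ) : 0 < isingPartition J :=
  Finset.sum_pos (fun _ _ => Real.exp_pos _) Finset.univ_nonempty

theorem isingProb_pos {n : ℕ} (J : Matrix (Fin n) (Fin n) ℝ) (x : SpinConfig n) :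
    0 < isingProb J x :=
  div_pos (Real.exp_pos _) (isingPartition_pos J)

theorem sum_isingProb {n : ℕ} (J : Matrix (Fin n) (Fin n) ℝ) :
    ∑ x : SpinConfig n, isingProb J x = 1 := by
  unfold isingProb
  rw [← Finset.sum_div]
  exact div_self (isingPartition_pos J).ne'

theorem curieWeiss_mem_zeroDiagSymm (n : ℕ) (β : ℝ) : curieWeiss n β ∈ zeroDiagSymm n := by
  refine ⟨?_, fun i => by simp [curieWeiss]⟩
  ext i j
  simp [curieWeiss, Matrix.one_apply, eq_comm]

/-! ### Scalar inequalities -/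

/-! Let A = J - J*, q(x) = ‖Ax‖², D = E_{J*} q. Then E_J q is the ratio of E_{J*}[q e^h] to
E_{J*}[e^h], with h = xᵀAx/2. Cauchy–Schwarz gives |h| ≤ (1 + nq)/4, and nD is bounded, so e^h costs
at most a small exponential of q/D. As q is a sum of squared linear forms (the rows of A), it
suffices that (u·x)²/E_{J*}(u·x)² has a uniform exponential moment (`isingRegular_of_exp_sq_le`).

For Curie–Weiss, Gaussian linearisation of the squared magnetisation mixes product measures; each
satisfies a sub-Gaussian bound with variance proxy of order W = Σu_i² + (Σu_i)², uniformly in the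
field (`isingExpectation_exp_sq_le`). The second moment is (1-ρ)Σu_i² + ρ(Σu_i)², where ρ is the
common pair correlation, so it dominates W once ρ stays away from 0 and 1
(`exists_correlation_bounds`). Flipping a spin keeps ρ from 1. For β > 1 the partition function
exceeds 2^n exponentially, which by Jensen keeps ρ from 0. -/

theorem one_add_sq_div_two_le_cosh (y : ℝ) : 1 + y ^ 2 / 2 ≤ Real.cosh y := by
  have h : Real.cosh y = 1 + 2 * Real.sinh (y / 2) ^ 2 := by
    have h1 := Real.cosh_two_mul (y / 2)
    rw [mul_div_cancel₀ y two_ne_zero, Real.cosh_sq] at h1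
    linarith
  have h2 : (y / 2) ^ 2 ≤ Real.sinh (y / 2) ^ 2 := by
    rw [sq_le_sq, Real.abs_sinh]
    exact Real.self_le_sinh_iff.2 (abs_nonneg _)
  rw [h]
  nlinarith

/-- The left side is the moment generating function of a ±1 variable of mean t. Its product with the
same function for -t is at most cosh² a ≤ exp(a²), and the latter is at least exp(-ta). -/
theorem cosh_add_mul_sinh_le {t : ℝ} (ht : |t| ≤ 1) (a : ℝ) :
    Real.cosh a + t * Real.sinh a ≤ Real.exp (t * a + a ^ 2) := by
  have h1 : Real.exp (-(t * a)) ≤ Real.cosh a - t * Real.sinh a := by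
    have := Real.exp_mul_le_cosh_add_mul_sinh (t := -t) (by rwa [abs_neg]) a
    simpa [sub_eq_add_neg] using this
  have h2 : (Real.cosh a + t * Real.sinh a) * (Real.cosh a - t * Real.sinh a) ≤
      Real.exp (a ^ 2) := by
    have h3 : Real.cosh a ^ 2 ≤ Real.exp (a ^ 2) := by
      calc Real.cosh a ^ 2 ≤ Real.exp (a ^ 2 / 2) ^ 2 :=
            pow_le_pow_left₀ (Real.cosh_pos a).le (Real.cosh_le_exp_half_sq a) 2
        _ = Real.exp (a ^ 2) := by rw [← Real.exp_nat_mul]; congr 1; push_cast; ring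
    nlinarith [sq_nonneg (t * Real.sinh a)]
  have h4 : 0 < Real.cosh a + t * Real.sinh a :=
    (Real.exp_pos _).trans_le (Real.exp_mul_le_cosh_add_mul_sinh ht a)
  rw [Real.exp_add, ← mul_inv_le_iff₀' (Real.exp_pos _), ← Real.exp_neg]
  exact (mul_le_mul_of_nonneg_left h1 h4.le).trans h2

theorem integrable_exp_mul_sub_mul_sq {b : ℝ} (hb : 0 < b) (t : ℝ) :
    MeasureTheory.Integrable (fun y : ℝ => Real.exp (y * t - b * y ^ 2)) := by
  have h := ((integrable_exp_neg_mul_sq hb).comp_sub_right (t / (2 * b))).mul_const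
    (Real.exp (t ^ 2 / (4 * b)))
  refine h.congr (Filter.Eventually.of_forall fun y => ?_)
  simp only [← Real.exp_add]
  congr 1
  field_simp
  ring

theorem integral_exp_mul_sub_mul_sq {b : ℝ} (hb : 0 < b) (t : ℝ) :
    ∫ y : ℝ, Real.exp (y * t - b * y ^ 2) =
      √(Real.pi / b) * Real.exp (t ^ 2 / (4 * b)) := by
  rw [← integral_gaussian b, ← MeasureTheory.integral_mul_const,
    ← MeasureTheory.integral_sub_right_eq_self
      (fun y : ℝ => Real.exp (-b * y ^ 2) * Real.exp (t ^ 2 / (4 * b))) (t / (2 * b))]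
  congr 1
  ext y
  rw [← Real.exp_add]
  congr 1
  field_simp
  ring

/-! ### Expectations under an Ising model -/

section Expectation

variable {n : ℕ} (J : Matrix (Fin n) (Fin n) ℝ)

theorem isingExpectation_mono {f g : SpinConfig n → ℝ} (h : ∀ x, f x ≤ g x) :
    isingExpectation J f ≤ isingExpectation J g :=
  Finset.sum_le_sum fun x _ => mul_le_mul_of_nonneg_left (h x) (isingProb_pos J x).le

theorem isingExpectation_nonneg {f : SpinConfig n → ℝ} (h : ∀ x, 0 ≤ f x) :
    0 ≤ isingExpectation J f :=
  Finset.sum_nonneg fun x _ => mul_nonneg (isingProb_pos J x).le (h x)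

theorem isingExpectation_const (c : ℝ) : isingExpectation J (fun _ => c) = c := by
  simp [isingExpectation, ← Finset.sum_mul, sum_isingProb]

theorem isingExpectation_mul_left (c : ℝ) (f : SpinConfig n → ℝ) :
    isingExpectation J (fun x => c * f x) = c * isingExpectation J f := by
  simp only [isingExpectation, Finset.mul_sum]
  exact Finset.sum_congr rfl fun x _ => by ring

theorem isingExpectation_add (f g : SpinConfig n → ℝ) :
    isingExpectation J (fun x => f x + g x) = isingExpectation J f + isingExpectation J g := by
  simp only [isingExpectation, mul_add, Finset.sum_add_distrib]

theorem isingExpectation_sum {ι : Type*} (s : Finset ι) (f : ι → SpinConfig n → ℝ) :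
    isingExpectation J (fun x => ∑ i ∈ s, f i x) = ∑ i ∈ s, isingExpectation J (f i) := by
  simp only [isingExpectation, Finset.mul_sum]
  exact Finset.sum_comm

theorem isingExpectation_eq_zero_iff {f : SpinConfig n → ℝ} (h : ∀ x, 0 ≤ f x) :
    isingExpectation J f = 0 ↔ ∀ x, f x = 0 := by
  rw [isingExpectation, Finset.sum_eq_zero_iff_of_nonneg
    fun x _ => mul_nonneg (isingProb_pos J x).le (h x)]
  simp [(isingProb_pos J _).ne']

theorem isingPartition_mul_isingExpectation (f : SpinConfig n → ℝ) :
    isingPartition J * isingExpectation J f = ∑ x, isingWeight J x * f x := by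
  simp only [isingExpectation, isingProb, Finset.mul_sum]
  refine Finset.sum_congr rfl fun x _ => ?_
  field_simp [(isingPartition_pos J).ne']

theorem isingExpectation_le_iff (f : SpinConfig n → ℝ) (c : ℝ) :
    isingExpectation J f ≤ c ↔ ∑ x, isingWeight J x * f x ≤ c * isingPartition J := by
  rw [← isingPartition_mul_isingExpectation, mul_comm c]
  exact (mul_le_mul_iff_right₀ (isingPartition_pos J)).symm

/-- Jensen's inequality for the exponential. -/
theorem exp_isingExpectation_le (f : SpinConfig n → ℝ) :
    Real.exp (isingExpectation J f) ≤ isingExpectation J (fun x => Real.exp (f x)) := by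
  have := convexOn_exp.map_sum_le (t := Finset.univ) (w := isingProb J) (p := f)
    (fun x _ => (isingProb_pos J x).le) (sum_isingProb J) (fun _ _ => Set.mem_univ _)
  simpa [isingExpectation] using this

/-- Change of interaction matrix: the density of `Pr_J` with respect to `Pr_{J'}` is proportional
to `exp (xᵀ (J - J') x / 2)`. -/
theorem isingExpectation_change (J' : Matrix (Fin n) (Fin n) ℝ) (f : SpinConfig n → ℝ) :
    isingExpectation J f *
        isingExpectation J' (fun x => Real.exp (1 / 2 * (x.toVec ⬝ᵥ ((J - J') *ᵥ x.toVec)))) =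
      isingExpectation J' (fun x =>
        f x * Real.exp (1 / 2 * (x.toVec ⬝ᵥ ((J - J') *ᵥ x.toVec)))) := by
  have hw : ∀ x : SpinConfig n, isingWeight J' x *
      Real.exp (1 / 2 * (x.toVec ⬝ᵥ ((J - J') *ᵥ x.toVec))) = isingWeight J x := by
    intro x
    rw [isingWeight, isingWeight, ← Real.exp_add, Matrix.sub_mulVec, dotProduct_sub]
    congr 1
    ring
  have h1 := isingPartition_mul_isingExpectation J'
    (fun x => Real.exp (1 / 2 * (x.toVec ⬝ᵥ ((J - J') *ᵥ x.toVec))))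
  have h2 := isingPartition_mul_isingExpectation J'
    (fun x => f x * Real.exp (1 / 2 * (x.toVec ⬝ᵥ ((J - J') *ᵥ x.toVec))))
  simp only [hw] at h1
  simp only [mul_left_comm _ (f _), hw] at h2
  have h3 := isingPartition_mul_isingExpectation J f
  simp only [mul_comm (isingWeight J _)] at h3
  apply mul_left_cancel₀ (isingPartition_pos J').ne'
  rw [h2, ← h3, mul_left_comm, h1, isingPartition, mul_comm]

end Expectation

/-! ### Spin vectors: norms, quadratic forms and exponential sums. -/

theorem SpinConfig.toVec_sq {n : ℕ} (x : SpinConfig n) (i : Fin n) : x.toVec i ^ 2 = 1 := by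
  rcases Int.units_eq_one_or (x i) with h | h <;> simp [SpinConfig.toVec, h]

theorem SpinConfig.toVec_mul_self {n : ℕ} (x : SpinConfig n) (i : Fin n) :
    x.toVec i * x.toVec i = 1 := by
  rw [← sq, x.toVec_sq]

theorem sqNormMulSpin_eq {n : ℕ} (A : Matrix (Fin n) (Fin n) ℝ) (x : SpinConfig n) :
    sqNormMulSpin A x = ∑ i, (A i ⬝ᵥ x.toVec) ^ 2 := by
  rw [sqNormMulSpin, EuclideanSpace.real_norm_sq_eq]
  rfl

theorem sq_dotProduct_mulVec_le {n : ℕ} (A : Matrix (Fin n) (Fin n) ℝ) (x : SpinConfig n) :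
    (x.toVec ⬝ᵥ (A *ᵥ x.toVec)) ^ 2 ≤ n * sqNormMulSpin A x := by
  have h := Finset.sum_mul_sq_le_sq_mul_sq Finset.univ x.toVec (A *ᵥ x.toVec)
  simp only [x.toVec_sq] at h
  rw [sqNormMulSpin_eq]
  rw [Finset.sum_const, Finset.card_univ, Fintype.card_fin, nsmul_one] at h
  exact h

theorem sum_exp_dotProduct {n : ℕ} (a : Fin n → ℝ) :
    ∑ x : SpinConfig n, Real.exp (a ⬝ᵥ x.toVec) = ∏ i, (2 * Real.cosh (a i)) := by
  have h1 : ∀ i, 2 * Real.cosh (a i) = ∑ s : ℤˣ, Real.exp (a i * ((s : ℤ) : ℝ)) := by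
    intro i
    rw [show (Finset.univ : Finset ℤˣ) = {1, -1} from rfl, Finset.sum_pair (by decide),
      Real.cosh_eq]
    simp
    ring
  simp_rw [h1]
  rw [Finset.prod_univ_sum, Fintype.piFinset_univ]
  refine Finset.sum_congr rfl fun x _ => ?_
  rw [← Real.exp_sum]
  rfl

/-! ### Regularity from exponential integrability of linear forms -/

/-- If every linear form `u ⬝ x`, normalised to have second moment one, has a square with an
exponential moment that is bounded uniformly in `u`, then the model is regular. -/
theorem isingRegular_of_exp_sq_le {n : ℕ} (hn : 1 ≤ n) (Js : Matrix (Fin n) (Fin n) ℝ)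
    {c K : ℝ} (hc : 0 < c) (hK : 0 < K)
    (h : ∀ u : Fin n → ℝ, isingExpectation Js (fun x => Real.exp (c * ((u ⬝ᵥ x.toVec) ^ 2 /
      isingExpectation Js (fun x => (u ⬝ᵥ x.toVec) ^ 2)))) ≤ K) :
    IsingRegular Js (2 * c / n) (2 / c * Real.exp (1 / 4) * K * Real.exp ((1 + 2 * c) / 4)) := by
  have hn0 : (0 : ℝ) < n := by exact_mod_cast hn
  refine ⟨by positivity, by positivity, fun J _ hD => ?_⟩
  set A := J - Js with hA
  set D := isingExpectation Js (sqNormMulSpin A) with hDdef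
  have hq0 : ∀ x, 0 ≤ sqNormMulSpin A x := fun x => sq_nonneg _
  have hD0 : 0 ≤ D := isingExpectation_nonneg Js hq0
  rcases hD0.eq_or_lt with hDz | hDpos
  · have hz := (isingExpectation_eq_zero_iff Js hq0).1 hDz.symm
    rw [(isingExpectation_eq_zero_iff J hq0).2 hz, ← hDz, mul_zero]
  have hnD : n * D ≤ 2 * c := by rwa [le_div_iff₀ hn0, mul_comm] at hD
  have hquad : ∀ x : SpinConfig n, |x.toVec ⬝ᵥ (A *ᵥ x.toVec)| ≤
      (1 + n * sqNormMulSpin A x) / 2 := by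
    intro x
    have h1 := sq_dotProduct_mulVec_le A x
    rw [← sq_abs] at h1
    nlinarith [sq_nonneg (|x.toVec ⬝ᵥ (A *ᵥ x.toVec)| - 1)]
  -- q/D is the average of the normalised squares of the rows with weights V i / D; Jensen then
  -- applies pointwise.
  have hrows : isingExpectation Js (fun x => Real.exp (c * (sqNormMulSpin A x / D))) ≤ K := by
    set V : Fin n → ℝ := fun i => isingExpectation Js (fun x => (A i ⬝ᵥ x.toVec) ^ 2) with hV
    have hV0 : ∀ i, 0 ≤ V i := fun i => isingExpectation_nonneg Js fun x => sq_nonneg _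
    have hVD : ∑ i, V i = D := by
      rw [hDdef, hV, ← isingExpectation_sum]
      exact congrArg _ (funext fun x => (sqNormMulSpin_eq A x).symm)
    have hw1 : ∑ i, V i / D = 1 := by rw [← Finset.sum_div, hVD, div_self hDpos.ne']
    have hpt : ∀ x : SpinConfig n, Real.exp (c * (sqNormMulSpin A x / D)) ≤
        ∑ i, V i / D * Real.exp (c * ((A i ⬝ᵥ x.toVec) ^ 2 / V i)) := by
      intro x
      have := convexOn_exp.map_sum_le (t := Finset.univ) (w := fun i => V i / D)
        (p := fun i => c * ((A i ⬝ᵥ x.toVec) ^ 2 / V i))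
        (fun i _ => div_nonneg (hV0 i) hDpos.le) hw1 (fun _ _ => Set.mem_univ _)
      simp only [smul_eq_mul] at this
      refine le_of_eq_of_le (congrArg Real.exp ?_) this
      rw [sqNormMulSpin_eq, Finset.sum_div, Finset.mul_sum]
      refine Finset.sum_congr rfl fun i _ => ?_
      -- If V i = 0, the form vanishes at every configuration, all masses being positive, so
      -- division by zero does no harm.
      rcases (hV0 i).eq_or_lt with hz | hpos
      · have := (isingExpectation_eq_zero_iff Js fun x => sq_nonneg _).1 hz.symm x
        simp [this]
      · field_simp
    calc _ ≤ isingExpectation Js (fun x =>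
            ∑ i, V i / D * Real.exp (c * ((A i ⬝ᵥ x.toVec) ^ 2 / V i))) :=
          isingExpectation_mono Js hpt
      _ = ∑ i, V i / D * isingExpectation Js
            (fun x => Real.exp (c * ((A i ⬝ᵥ x.toVec) ^ 2 / V i))) := by
          rw [isingExpectation_sum]
          exact Finset.sum_congr rfl fun i _ => isingExpectation_mul_left Js _ _
      _ ≤ ∑ i, V i / D * K := Finset.sum_le_sum fun i _ =>
          mul_le_mul_of_nonneg_left (h (A i)) (div_nonneg (hV0 i) hDpos.le)
      _ = K := by rw [← Finset.sum_mul, hw1, one_mul]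
  have hnum : isingExpectation Js (fun x => sqNormMulSpin A x *
      Real.exp (1 / 2 * (x.toVec ⬝ᵥ (A *ᵥ x.toVec)))) ≤ 2 / c * Real.exp (1 / 4) * D * K := by
    calc _ ≤ isingExpectation Js (fun x => (2 / c * Real.exp (1 / 4) * D) *
            Real.exp (c * (sqNormMulSpin A x / D))) := by
          refine isingExpectation_mono Js fun x => ?_
          set r := sqNormMulSpin A x / D with hr
          have hqr : sqNormMulSpin A x = D * r := by rw [hr]; field_simp
          have hr0 : 0 ≤ r := div_nonneg (hq0 x) hD0
          -- Half of the exponent c r absorbs the factor r, the other half absorbs the density.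
          have h1 : r ≤ 2 / c * Real.exp (c / 2 * r) := by
            have := Real.add_one_le_exp (c / 2 * r)
            rw [div_mul_eq_mul_div, le_div_iff₀ hc]
            linarith
          have h2 : Real.exp (1 / 2 * (x.toVec ⬝ᵥ (A *ᵥ x.toVec))) ≤
              Real.exp (1 / 4 + c / 2 * r) := by
            apply Real.exp_le_exp.2
            have h3 := (le_abs_self _).trans (hquad x)
            have h4 : n * sqNormMulSpin A x ≤ 2 * c * r := by
              rw [hqr, ← mul_assoc]
              exact mul_le_mul_of_nonneg_right hnD hr0
            linarith
          calc sqNormMulSpin A x * Real.exp (1 / 2 * (x.toVec ⬝ᵥ (A *ᵥ x.toVec)))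
              ≤ (D * (2 / c * Real.exp (c / 2 * r))) * Real.exp (1 / 4 + c / 2 * r) := by
                rw [hqr]
                gcongr
            _ = (2 / c * Real.exp (1 / 4) * D) * Real.exp (c * r) := by
                rw [show c * r = c / 2 * r + c / 2 * r by ring, Real.exp_add, Real.exp_add]
                ring
      _ ≤ _ := by
          rw [isingExpectation_mul_left]
          exact mul_le_mul_of_nonneg_left hrows (by positivity)
  -- Jensen, with mean exponent at least -(1 + nD)/4.
  have hden : Real.exp (-((1 + 2 * c) / 4)) ≤ isingExpectation Js (fun x =>
      Real.exp (1 / 2 * (x.toVec ⬝ᵥ (A *ᵥ x.toVec)))) := by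
    refine le_trans (Real.exp_le_exp.2 ?_) (exp_isingExpectation_le Js _)
    have h1 : isingExpectation Js (fun x => -(1 / 4) + -(n / 4) * sqNormMulSpin A x) ≤
        isingExpectation Js (fun x => 1 / 2 * (x.toVec ⬝ᵥ (A *ᵥ x.toVec))) := by
      refine isingExpectation_mono Js fun x => ?_
      have := (neg_le_abs _).trans (hquad x)
      linarith
    rw [isingExpectation_add, isingExpectation_const, isingExpectation_mul_left] at h1
    change -(1 / 4) + -(n / 4) * D ≤ _ at h1
    linarith
  have hch := isingExpectation_change J Js (sqNormMulSpin A)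
  rw [← hA] at hch
  have h5 := (mul_le_mul_of_nonneg_left hden (isingExpectation_nonneg J hq0)).trans
    (hch.trans_le hnum)
  rw [Real.exp_neg, mul_inv_le_iff₀ (Real.exp_pos _)] at h5
  linarith

/-! ### The Curie–Weiss model -/

section CurieWeiss

variable {n : ℕ} (β : ℝ)

theorem curieWeiss_dotProduct_mulVec (x : SpinConfig n) :
    x.toVec ⬝ᵥ (curieWeiss n β *ᵥ x.toVec) = β / n * ((∑ i, x.toVec i) ^ 2 - n) := by
  have h1 : (Matrix.of (fun _ _ => (1 : ℝ)) : Matrix (Fin n) (Fin n) ℝ) *ᵥ x.toVec =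
      fun _ => ∑ i, x.toVec i := by
    ext i
    simp [Matrix.mulVec, dotProduct]
  have h2 : x.toVec ⬝ᵥ x.toVec = n := by simp [dotProduct, x.toVec_mul_self]
  rw [curieWeiss, Matrix.smul_mulVec, Matrix.sub_mulVec, h1, Matrix.one_mulVec,
    dotProduct_smul, dotProduct_sub, h2, smul_eq_mul]
  congr 2
  simp [dotProduct, ← Finset.sum_mul, sq]

theorem isingWeight_curieWeiss (x : SpinConfig n) :
    isingWeight (curieWeiss n β) x =
      Real.exp (-(β / (2 * n) * n)) * Real.exp (β / (2 * n) * (∑ i, x.toVec i) ^ 2) := by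
  rw [isingWeight, curieWeiss_dotProduct_mulVec, ← Real.exp_add]
  congr 1
  ring

/-- Independent spins in field h have mean tanh h, which enters only through |tanh h| ≤ 1; the
prefactor is therefore free of h and survives integration over h. -/
theorem sum_exp_add_le (u : Fin n → ℝ) (s h : ℝ) :
    ∑ x : SpinConfig n, Real.exp (s * (u ⬝ᵥ x.toVec)) * Real.exp (h * ∑ i, x.toVec i) ≤
      Real.exp (1 / 2 + s ^ 2 * (∑ i, u i ^ 2 + (∑ i, u i) ^ 2)) *
        ∑ x : SpinConfig n, Real.exp (h * ∑ i, x.toVec i) := by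
  have e1 : ∀ x : SpinConfig n, Real.exp (s * (u ⬝ᵥ x.toVec)) * Real.exp (h * ∑ i, x.toVec i) =
      Real.exp ((fun i => s * u i + h) ⬝ᵥ x.toVec) := by
    intro x
    rw [← Real.exp_add]
    simp only [dotProduct, add_mul, Finset.sum_add_distrib, Finset.mul_sum, mul_assoc]
  have e2 : ∀ x : SpinConfig n, Real.exp (h * ∑ i, x.toVec i) =
      Real.exp ((fun _ => h) ⬝ᵥ x.toVec) := by
    intro x
    simp only [dotProduct, Finset.mul_sum]
  simp_rw [e1, e2]
  rw [sum_exp_dotProduct, sum_exp_dotProduct]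
  set t := Real.tanh h with ht
  have ht1 : |t| ≤ 1 := (Real.abs_tanh_lt_one h).le
  have hfac : ∀ i, 2 * Real.cosh (s * u i + h) ≤
      Real.exp (t * (s * u i) + (s * u i) ^ 2) * (2 * Real.cosh h) := by
    intro i
    have := cosh_add_mul_sinh_le ht1 (s * u i)
    have hc := Real.cosh_pos h
    have hs : Real.sinh h = t * Real.cosh h := by
      rw [ht, Real.tanh_eq_sinh_div_cosh]; field_simp
    rw [Real.cosh_add, hs]
    nlinarith
  calc _ ≤ ∏ i, (Real.exp (t * (s * u i) + (s * u i) ^ 2) * (2 * Real.cosh h)) :=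
        Finset.prod_le_prod (fun i _ => by positivity) fun i _ => hfac i
    _ = Real.exp (t * (s * ∑ i, u i) + s ^ 2 * ∑ i, u i ^ 2) * ∏ _i : Fin n, (2 * Real.cosh h) := by
        rw [Finset.prod_mul_distrib, ← Real.exp_sum]
        congr 2
        simp only [Finset.sum_add_distrib, Finset.mul_sum, mul_pow]
    _ ≤ _ := by
        refine mul_le_mul_of_nonneg_right (Real.exp_le_exp.2 ?_)
          (Finset.prod_nonneg fun i _ => by positivity)
        set a := s * ∑ i, u i with ha
        have h1 : t * a ≤ |a| := by
          calc t * a ≤ |t * a| := le_abs_self _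
            _ = |t| * |a| := abs_mul _ _
            _ ≤ 1 * |a| := mul_le_mul_of_nonneg_right ht1 (abs_nonneg _)
            _ = |a| := one_mul _
        have h2 : s ^ 2 * (∑ i, u i) ^ 2 = |a| ^ 2 := by rw [sq_abs, ha, mul_pow]
        rw [mul_add, h2]
        nlinarith [sq_nonneg (|a| - 1), sq_nonneg |a|]

variable {β}

/-- Gaussian linearisation of a square in the exponent of the right factor. -/
theorem sum_mul_exp_sq_le_of_forall {ι : Type*} (s : Finset ι) {b C : ℝ} (hb : 0 < b)
    (p t : ι → ℝ)
    (h : ∀ y : ℝ, ∑ i ∈ s, p i * Real.exp (y * t i) ≤ C * ∑ i ∈ s, Real.exp (y * t i)) :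
    ∑ i ∈ s, p i * Real.exp (t i ^ 2 / (4 * b)) ≤ C * ∑ i ∈ s, Real.exp (t i ^ 2 / (4 * b)) := by
  have hint := fun i => integrable_exp_mul_sub_mul_sq hb (t i)
  have hpi : 0 < √(Real.pi / b) := Real.sqrt_pos.2 (div_pos Real.pi_pos hb)
  have key : ∫ y : ℝ, ∑ i ∈ s, p i * Real.exp (y * t i - b * y ^ 2) ≤
      ∫ y : ℝ, C * ∑ i ∈ s, Real.exp (y * t i - b * y ^ 2) := by
    refine MeasureTheory.integral_mono
      (MeasureTheory.integrable_finsetSum _ fun i _ => (hint i).const_mul _)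
      ((MeasureTheory.integrable_finsetSum _ fun i _ => hint i).const_mul _) fun y => ?_
    have := mul_le_mul_of_nonneg_right (h y) (Real.exp_pos (-(b * y ^ 2))).le
    simpa only [sub_eq_add_neg, Real.exp_add, mul_assoc, Finset.sum_mul] using this
  rw [MeasureTheory.integral_finsetSum _ fun i _ => (hint i).const_mul _,
    MeasureTheory.integral_const_mul,
    MeasureTheory.integral_finsetSum _ fun i _ => hint i] at key
  simp only [MeasureTheory.integral_const_mul, integral_exp_mul_sub_mul_sq hb,
    mul_left_comm (p _), ← Finset.mul_sum, mul_left_comm C] at key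
  exact le_of_mul_le_mul_left key hpi

/-- Linear forms are sub-Gaussian around the direction of the magnetisation. -/
theorem isingExpectation_exp_le (hβ : 0 < β) (hn : 1 ≤ n) (u : Fin n → ℝ) (s : ℝ) :
    isingExpectation (curieWeiss n β) (fun x => Real.exp (s * (u ⬝ᵥ x.toVec))) ≤
      Real.exp (1 / 2 + s ^ 2 * (∑ i, u i ^ 2 + (∑ i, u i) ^ 2)) := by
  have hn0 : (0 : ℝ) < n := by exact_mod_cast hn
  rw [isingExpectation_le_iff]
  -- Chosen so that 1/(4b) = β/(2n), the coefficient of the squared magnetisation.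
  have hb : 0 < n / (2 * β) := by positivity
  have := sum_mul_exp_sq_le_of_forall Finset.univ hb _ _ (fun h => sum_exp_add_le u s h)
  have e : ∀ S : ℝ, S ^ 2 / (4 * (n / (2 * β))) = β / (2 * n) * S ^ 2 := by
    intro S; field_simp; ring
  simp only [e] at this
  have h2 := mul_le_mul_of_nonneg_left this (Real.exp_pos (-(β / (2 * n) * n))).le
  simp only [isingPartition, isingWeight_curieWeiss, ← Finset.mul_sum, mul_assoc,
    mul_comm (Real.exp (β / _ * _)), mul_left_comm _ (Real.exp (-(β / (2 * n) * n)))] at h2 ⊢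
  exact h2

/-- The bound exp(1/2 + y²W) is integrated against exp(-2Wy²): the left side produces the square
with coefficient 1/(8W), and the two Gaussian normalisations differ by √2. -/
theorem isingExpectation_exp_sq_le (hβ : 0 < β) (hn : 1 ≤ n) (u : Fin n → ℝ)
    (hu : 0 < ∑ i, u i ^ 2 + (∑ i, u i) ^ 2) :
    isingExpectation (curieWeiss n β) (fun x => Real.exp (1 / 8 *
      ((u ⬝ᵥ x.toVec) ^ 2 / (∑ i, u i ^ 2 + (∑ i, u i) ^ 2)))) ≤ √2 * Real.exp (1 / 2) := by
  set W := ∑ i, u i ^ 2 + (∑ i, u i) ^ 2 with hW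
  clear_value W
  have hb : 0 < 2 * W := by positivity
  have hint := fun x : SpinConfig n => integrable_exp_mul_sub_mul_sq hb (u ⬝ᵥ x.toVec)
  have hpi : 0 < √(Real.pi / (2 * W)) := Real.sqrt_pos.2 (div_pos Real.pi_pos hb)
  have key : ∫ y : ℝ, ∑ x : SpinConfig n, isingProb (curieWeiss n β) x *
        Real.exp (y * (u ⬝ᵥ x.toVec) - 2 * W * y ^ 2) ≤
      ∫ y : ℝ, Real.exp (1 / 2) * Real.exp (-W * y ^ 2) := by
    refine MeasureTheory.integral_mono
      (MeasureTheory.integrable_finsetSum _ fun i _ => (hint i).const_mul _)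
      ((integrable_exp_neg_mul_sq hu).const_mul _) fun y => ?_
    have := mul_le_mul_of_nonneg_right (isingExpectation_exp_le hβ hn u y)
      (Real.exp_pos (-(2 * W * y ^ 2))).le
    rw [← hW, ← Real.exp_add, isingExpectation, Finset.sum_mul] at this
    simp only [mul_assoc, ← Real.exp_add] at this ⊢
    rwa [show 1 / 2 + -W * y ^ 2 = 1 / 2 + y ^ 2 * W + -(2 * (W * y ^ 2)) by ring]
  rw [MeasureTheory.integral_finsetSum _ fun i _ => (hint i).const_mul _,
    MeasureTheory.integral_const_mul, integral_gaussian] at key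
  simp only [MeasureTheory.integral_const_mul, integral_exp_mul_sub_mul_sq hb,
    mul_left_comm (isingProb _ _), ← Finset.mul_sum] at key
  have hsq : √(Real.pi / W) = √(Real.pi / (2 * W)) * √2 := by
    rw [← Real.sqrt_mul (by positivity)]
    congr 1
    field_simp
  rw [hsq, mul_left_comm, mul_comm (Real.exp _), mul_assoc] at key
  have key' := le_of_mul_le_mul_left key hpi
  refine le_trans (le_of_eq ?_) key'
  refine Finset.sum_congr rfl fun x _ =>
    congrArg (fun r => isingProb (curieWeiss n β) x * Real.exp r) ?_
  field_simp
  ring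

end CurieWeiss

/-! ### Pair correlations of the Curie–Weiss model -/

section Correlation

variable {n : ℕ} {β : ℝ}

theorem isingExpectation_curieWeiss_perm (σ : Equiv.Perm (Fin n)) (f : SpinConfig n → ℝ) :
    isingExpectation (curieWeiss n β) (fun x => f (fun i => x (σ i))) =
      isingExpectation (curieWeiss n β) f := by
  refine Fintype.sum_equiv (Equiv.arrowCongr σ.symm (Equiv.refl ℤˣ)) _ _
    fun (x : SpinConfig n) => ?_
  have h1 : (Equiv.arrowCongr σ.symm (Equiv.refl ℤˣ)) x = fun i => x (σ i) := by
    ext i; simp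
  have h2 : ∑ i, SpinConfig.toVec (fun i => x (σ i)) i = ∑ i, x.toVec i :=
    Equiv.sum_comp σ x.toVec
  rw [h1, isingProb, isingProb, isingWeight_curieWeiss, isingWeight_curieWeiss, h2]

/-- Exchangeability: the weight depends only on the sum of the spins. -/
theorem exists_pair_correlation (n : ℕ) (β : ℝ) : ∃ ρ : ℝ, ∀ i j : Fin n, i ≠ j →
    isingExpectation (curieWeiss n β) (fun x => x.toVec i * x.toVec j) = ρ := by
  set r : Fin n → Fin n → ℝ := fun i j =>
    isingExpectation (curieWeiss n β) (fun x => x.toVec i * x.toVec j) with hr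
  have hsymm : ∀ i j, r i j = r j i := fun i j => by simp only [hr, mul_comm]
  have hmove : ∀ i j l, i ≠ j → i ≠ l → r i j = r i l := by
    intro i j l hij hil
    have := isingExpectation_curieWeiss_perm (β := β) (Equiv.swap j l)
      (fun x => x.toVec i * x.toVec j)
    simp only [SpinConfig.toVec, Equiv.swap_apply_of_ne_of_ne hij hil,
      Equiv.swap_apply_left] at this
    exact this.symm
  by_cases h : ∃ k l : Fin n, k ≠ l
  · obtain ⟨k, l, hkl⟩ := h
    refine ⟨r k l, fun i j hij => ?_⟩
    change r i j = r k l
    by_cases hik : i = k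
    · subst hik; exact hmove _ _ _ hij hkl
    · rw [hmove i j k hij hik, hsymm, hmove k i l (Ne.symm hik) hkl]
  · exact ⟨0, fun i j hij => (h ⟨i, j, hij⟩).elim⟩

theorem isingExpectation_sq_dotProduct {ρ : ℝ} (hρ : ∀ i j : Fin n, i ≠ j →
    isingExpectation (curieWeiss n β) (fun x => x.toVec i * x.toVec j) = ρ) (u : Fin n → ℝ) :
    isingExpectation (curieWeiss n β) (fun x => (u ⬝ᵥ x.toVec) ^ 2) =
      (1 - ρ) * ∑ i, u i ^ 2 + ρ * (∑ i, u i) ^ 2 := by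
  have h1 : ∀ i j, isingExpectation (curieWeiss n β) (fun x => x.toVec i * x.toVec j) =
      ρ + if i = j then 1 - ρ else 0 := by
    intro i j
    split_ifs with h
    · subst h
      simp only [SpinConfig.toVec_mul_self, isingExpectation_const]
      ring
    · rw [hρ i j h, add_zero]
  have h2 : ∀ x : SpinConfig n, (u ⬝ᵥ x.toVec) ^ 2 =
      ∑ i, ∑ j, (u i * u j) * (x.toVec i * x.toVec j) := by
    intro x
    rw [sq, dotProduct, Finset.sum_mul_sum]
    exact Finset.sum_congr rfl fun i _ => Finset.sum_congr rfl fun j _ => by ring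
  simp only [h2, isingExpectation_sum, isingExpectation_mul_left, h1]
  simp only [mul_add, Finset.sum_add_distrib, mul_ite, mul_zero, Finset.sum_ite_eq,
    Finset.mem_univ, if_true, ← Finset.sum_mul, ← Finset.sum_mul_sum]
  rw [add_comm, Finset.sum_mul_sum]
  simp only [← Finset.sum_mul, ← Finset.mul_sum, sq]
  ring

/-- Flipping one spin changes the weight by at most a factor `exp (2 β)`. -/
theorem one_add_correlation_le (hβ : 0 < β) {i j : Fin n} (hij : i ≠ j) :
    1 + isingExpectation (curieWeiss n β) (fun x => x.toVec i * x.toVec j) ≤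
      Real.exp (2 * β) *
        (1 - isingExpectation (curieWeiss n β) (fun x => x.toVec i * x.toVec j)) := by
  have hn0 : (0 : ℝ) < n := by exact_mod_cast i.pos
  set F : SpinConfig n → SpinConfig n := fun x => Function.update x i (-x i) with hF
  have hFinv : Function.Involutive F := by
    intro x
    simp [hF]
  have hFi : ∀ x, (F x).toVec i = -x.toVec i := by
    intro x; simp [hF, SpinConfig.toVec]
  have hFk : ∀ x k, k ≠ i → (F x).toVec k = x.toVec k := by
    intro x k hk; simp [hF, SpinConfig.toVec, hk]
  have hFS : ∀ x, ∑ k, (F x).toVec k = ∑ k, x.toVec k - 2 * x.toVec i := by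
    intro x
    rw [← Finset.add_sum_erase _ _ (Finset.mem_univ i),
      ← Finset.add_sum_erase _ x.toVec (Finset.mem_univ i), hFi,
      Finset.sum_congr rfl fun k hk => hFk x k (Finset.ne_of_mem_erase hk)]
    ring
  have hprob : ∀ x, isingProb (curieWeiss n β) x ≤
      Real.exp (2 * β) * isingProb (curieWeiss n β) (F x) := by
    intro x
    rw [isingProb, isingProb, ← mul_div_assoc]
    refine div_le_div_of_nonneg_right ?_ (isingPartition_pos _).le
    rw [isingWeight_curieWeiss, isingWeight_curieWeiss, mul_left_comm, hFS,
      ← Real.exp_add (2 * β)]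
    refine mul_le_mul_of_nonneg_left (Real.exp_le_exp.2 ?_) (Real.exp_pos _).le
    set S := ∑ k, x.toVec k with hS
    have hS1 : x.toVec i * S ≤ n := by
      rw [hS, Finset.mul_sum]
      calc ∑ k, x.toVec i * x.toVec k ≤ ∑ _k : Fin n, (1 : ℝ) :=
            Finset.sum_le_sum fun k _ => by
              nlinarith [sq_nonneg (x.toVec i - x.toVec k), x.toVec_sq i, x.toVec_sq k]
        _ = n := by simp
    -- The squared sum drops by 4 x_i S - 4 ≤ 4n; times β/(2n) this is 2β.
    have h1 : S ^ 2 ≤ 4 * n + (S - 2 * x.toVec i) ^ 2 := by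
      nlinarith [x.toVec_sq i]
    have h2 := mul_le_mul_of_nonneg_left h1 (show 0 ≤ β / (2 * n) by positivity)
    refine h2.trans (le_of_eq ?_)
    field_simp
    ring
  have hmain : isingExpectation (curieWeiss n β) (fun x => 1 + x.toVec i * x.toVec j) ≤
      Real.exp (2 * β) *
        isingExpectation (curieWeiss n β) (fun x => 1 + -1 * (x.toVec i * x.toVec j)) := by
    have e : isingExpectation (curieWeiss n β) (fun x => 1 + -1 * (x.toVec i * x.toVec j)) =
        ∑ x, isingProb (curieWeiss n β) (F x) * (1 + x.toVec i * x.toVec j) := by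
      rw [isingExpectation, ← Equiv.sum_comp hFinv.toPerm]
      refine Finset.sum_congr rfl fun x _ => ?_
      rw [Function.Involutive.coe_toPerm, hFi, hFk x j hij.symm]
      ring
    rw [e, isingExpectation, Finset.mul_sum]
    refine Finset.sum_le_sum fun x _ => ?_
    rw [← mul_assoc]
    refine mul_le_mul_of_nonneg_right (hprob x) ?_
    nlinarith [sq_nonneg (x.toVec i + x.toVec j), x.toVec_sq i, x.toVec_sq j]
  rw [isingExpectation_add, isingExpectation_add, isingExpectation_const,
    isingExpectation_mul_left] at hmain
  linarith

/-- The normalised partition function is controlled by the pair correlation (Jensen). -/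
theorem isingPartition_curieWeiss_le (hn : 1 ≤ n) {ρ : ℝ} (hρ : ∀ i j : Fin n, i ≠ j →
    isingExpectation (curieWeiss n β) (fun x => x.toVec i * x.toVec j) = ρ) :
    isingPartition (curieWeiss n β) ≤ 2 ^ n * Real.exp (β * (n - 1) * ρ / 2) := by
  have hn0 : (0 : ℝ) < n := by exact_mod_cast hn
  set Js := curieWeiss n β with hJs
  set H : SpinConfig n → ℝ := fun x => -((1 / 2 : ℝ) * (x.toVec ⬝ᵥ (Js *ᵥ x.toVec))) with hH
  have h1 := exp_isingExpectation_le Js H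
  -- The weight cancels against exp(H), leaving the number of configurations.
  have h2 : isingPartition Js * isingExpectation Js (fun x => Real.exp (H x)) = 2 ^ n := by
    rw [isingPartition_mul_isingExpectation]
    have : ∀ x, isingWeight Js x * Real.exp (H x) = 1 := by
      intro x
      rw [isingWeight, hH, ← Real.exp_add, add_neg_cancel, Real.exp_zero]
    simp [this]
  have h3 : isingExpectation Js H = -(β * (n - 1) * ρ / 2) := by
    have e : H = fun x => β / 2 + -(β / (2 * n)) * ((fun _ => (1 : ℝ)) ⬝ᵥ x.toVec) ^ 2 := by
      ext x
      simp only [hH, hJs, curieWeiss_dotProduct_mulVec]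
      simp only [dotProduct, one_mul]
      field_simp
      ring
    rw [e, isingExpectation_add, isingExpectation_const, isingExpectation_mul_left,
      isingExpectation_sq_dotProduct hρ]
    simp
    field_simp
    ring
  rw [h3, Real.exp_neg] at h1
  have h4 := mul_le_mul_of_nonneg_left h1 (isingPartition_pos Js).le
  rwa [h2, mul_inv_le_iff₀ (Real.exp_pos _)] at h4

/-- Near 0, log cosh(βt) - βt²/2 behaves like β(β-1)t²/2 > 0. With z = βt²/2 it suffices that
(1-z)(1+βz) > 1, that is βz < β-1; the witness takes half of that range. -/
theorem exists_cosh_eq_exp (hβ : 1 < β) :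
    ∃ t c : ℝ, 0 < c ∧ Real.cosh (β * t) = Real.exp (β * t ^ 2 / 2 + c) := by
  set z := (β - 1) / (2 * β) with hz
  have hβ0 : 0 < β := by linarith
  have hz0 : 0 < z := div_pos (by linarith) (by positivity)
  have hβz : β * z = (β - 1) / 2 := by rw [hz]; field_simp
  have hz1 : z < 1 := by nlinarith
  set t := √(2 * z / β) with ht
  have ht2 : t ^ 2 = 2 * z / β := Real.sq_sqrt (by positivity)
  have e1 : β * t ^ 2 / 2 = z := by rw [ht2]; field_simp
  have e2 : (β * t) ^ 2 / 2 = β * z := by rw [mul_pow, ht2]; field_simp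
  have h1 : Real.exp z < Real.cosh (β * t) := by
    calc Real.exp z ≤ (1 - z)⁻¹ := by
          rw [← inv_inv (Real.exp z), ← Real.exp_neg]
          exact inv_anti₀ (by linarith) (by linarith [Real.add_one_le_exp (-z)])
      _ < 1 + β * z := by
          rw [inv_lt_iff_one_lt_mul₀ (by linarith)]
          nlinarith
      _ ≤ Real.cosh (β * t) := e2 ▸ one_add_sq_div_two_le_cosh (β * t)
  refine ⟨t, Real.log (Real.cosh (β * t)) - z, ?_, ?_⟩
  · have := (Real.lt_log_iff_exp_lt (Real.cosh_pos (β * t))).2 h1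
    linarith
  · rw [e1, add_sub_cancel, Real.exp_log (Real.cosh_pos _)]

/-- Dropping (S - nt)² ≥ 0 replaces S² by its tangent at nt, and the sum factorises. -/
theorem le_isingPartition_curieWeiss (hβ : 0 < β) (hn : 1 ≤ n) {t c : ℝ}
    (h : Real.cosh (β * t) = Real.exp (β * t ^ 2 / 2 + c)) :
    2 ^ n * Real.exp (n * c - β / 2) ≤ isingPartition (curieWeiss n β) := by
  have hn0 : (0 : ℝ) < n := by exact_mod_cast hn
  calc 2 ^ n * Real.exp (n * c - β / 2)
      = Real.exp (-(β / 2) - n * (β * t ^ 2 / 2)) * ∏ _i : Fin n, (2 * Real.cosh (β * t)) := by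
        rw [h, Finset.prod_const, Finset.card_univ, Fintype.card_fin, mul_pow, mul_left_comm,
          ← Real.exp_nat_mul, ← Real.exp_add]
        congr 2
        ring
    _ = ∑ x : SpinConfig n, Real.exp (-(β / 2) - n * (β * t ^ 2 / 2)) *
          Real.exp ((fun _ => β * t) ⬝ᵥ x.toVec) := by
        rw [← Finset.mul_sum, sum_exp_dotProduct]
    _ ≤ _ := by
        refine Finset.sum_le_sum fun x _ => ?_
        rw [isingWeight_curieWeiss, ← Real.exp_add, ← Real.exp_add]
        apply Real.exp_le_exp.2
        simp only [dotProduct, ← Finset.mul_sum]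
        set S := ∑ i, x.toVec i
        have : 0 ≤ β / (2 * n) * (S - n * t) ^ 2 := by positivity
        have e : β / (2 * n) * (S - n * t) ^ 2 =
            β / (2 * n) * S ^ 2 - β * t * S + n * (β * t ^ 2 / 2) := by
          field_simp; ring
        have e2 : β / (2 * n) * n = β / 2 := by field_simp
        rw [e2]
        linarith

/-- exp(H) ≥ 1 + H, and H has zero sum over all configurations; the inequality is strict at the
all-ones configuration, where H ≠ 0. -/
theorem lt_isingPartition_curieWeiss (hβ : 0 < β) (hn : 2 ≤ n) :
    2 ^ n < isingPartition (curieWeiss n β) := by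
  have hn0 : (0 : ℝ) < n := by exact_mod_cast (by omega : 0 < n)
  have hn2 : (2 : ℝ) ≤ n := by exact_mod_cast hn
  set H : SpinConfig n → ℝ := fun x => (1 / 2 : ℝ) * (x.toVec ⬝ᵥ (curieWeiss n β *ᵥ x.toVec))
    with hH
  have hHz : ∑ x, (H x + 1) = 2 ^ n := by
    have h0 : ∀ i j : Fin n, i ≠ j →
        ∑ x : SpinConfig n, x.toVec i * x.toVec j = 0 := by
      intro i j hij
      have hinv : Function.Involutive
          (fun x : SpinConfig n => (Function.update x i (-x i) : SpinConfig n)) := by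
        intro x; simp
      have e := Equiv.sum_comp hinv.toPerm (fun x : SpinConfig n => x.toVec i * x.toVec j)
      simp [SpinConfig.toVec, Function.update_of_ne hij.symm] at e ⊢
      linarith
    have h1 : ∀ x : SpinConfig n, x.toVec ⬝ᵥ (curieWeiss n β *ᵥ x.toVec) =
        ∑ i, ∑ j, curieWeiss n β i j * (x.toVec i * x.toVec j) := by
      intro x
      simp only [dotProduct, Matrix.mulVec, Finset.mul_sum]
      exact Finset.sum_congr rfl fun i _ => Finset.sum_congr rfl fun j _ => by ring
    have h2 : ∑ x : SpinConfig n, x.toVec ⬝ᵥ (curieWeiss n β *ᵥ x.toVec) = 0 := by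
      simp only [h1]
      rw [Finset.sum_comm]
      refine Finset.sum_eq_zero fun i _ => ?_
      rw [Finset.sum_comm]
      refine Finset.sum_eq_zero fun j _ => ?_
      rw [← Finset.mul_sum]
      by_cases hij : i = j
      · subst hij
        rw [(curieWeiss_mem_zeroDiagSymm n β).2 i, zero_mul]
      · rw [h0 i j hij, mul_zero]
    rw [Finset.sum_add_distrib, hH, ← Finset.mul_sum, h2]
    simp
  rw [← hHz]
  refine Finset.sum_lt_sum (fun x _ => Real.add_one_le_exp (H x))
    ⟨fun _ => 1, Finset.mem_univ _, Real.add_one_lt_exp ?_⟩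
  rw [hH]
  simp only [curieWeiss_dotProduct_mulVec]
  simp [SpinConfig.toVec]
  refine ⟨⟨hβ.ne', by omega⟩, ?_⟩
  nlinarith

end Correlation

/-- Above the critical temperature parameter `β = 1` the pair correlations of the Curie–Weiss
model are bounded away from `0` and `1`, uniformly in the size of the system. -/
theorem exists_correlation_bounds {β : ℝ} (hβ : 1 < β) :
    ∃ κ : ℝ, 0 < κ ∧ ∀ n : ℕ, 2 ≤ n → ∃ ρ : ℝ, κ ≤ ρ ∧ κ ≤ 1 - ρ ∧ ∀ i j : Fin n, i ≠ j →
      isingExpectation (curieWeiss n β) (fun x => x.toVec i * x.toVec j) = ρ := by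
  have hβ0 : 0 < β := by linarith
  obtain ⟨t, c, hc, htc⟩ := exists_cosh_eq_exp hβ
  choose ρ hρ using fun n : ℕ => exists_pair_correlation n β
  have hpos : ∀ n : ℕ, 2 ≤ n → 0 < ρ n := by
    intro n hn
    have hn2 : (2 : ℝ) ≤ n := by exact_mod_cast hn
    have h1 := (lt_isingPartition_curieWeiss hβ0 hn).trans_le
      (isingPartition_curieWeiss_le (by omega) (hρ n))
    rw [lt_mul_iff_one_lt_right (by positivity), Real.one_lt_exp_iff] at h1
    by_contra h
    have : β * (n - 1) * ρ n ≤ 0 :=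
      mul_nonpos_of_nonneg_of_nonpos (mul_nonneg hβ0.le (by linarith)) (not_lt.1 h)
    linarith
  -- For n ≥ N, β/2 is at most half of nc, so the two bounds on the partition function give ρ ≥ c/β.
  -- Smaller n are finitely many, each with ρ > 0.
  obtain ⟨N, hN⟩ := exists_nat_ge (β / c)
  have hlarge : ∀ n : ℕ, 2 ≤ n → N ≤ n → c / β ≤ ρ n := by
    intro n hn hNn
    have hn2 : (2 : ℝ) ≤ n := by exact_mod_cast hn
    have hNn' : (N : ℝ) ≤ n := by exact_mod_cast hNn
    have h1 := (le_isingPartition_curieWeiss hβ0 (by omega) htc).trans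
      (isingPartition_curieWeiss_le (by omega) (hρ n))
    have h2 := Real.exp_le_exp.1 (le_of_mul_le_mul_left h1 (by positivity))
    have h3 : β ≤ n * c := (div_le_iff₀ hc).1 (hN.trans hNn')
    have h4 := mul_pos hβ0 (hpos n hn)
    rw [div_le_iff₀ hβ0]
    have h5 : n * c ≤ n * (ρ n * β) := by nlinarith
    exact le_of_mul_le_mul_left h5 (by linarith)
  have hsmall : ∃ κ : ℝ, 0 < κ ∧ ∀ n ∈ Finset.Icc 2 (N + 2), κ ≤ ρ n := by
    obtain ⟨m, hm, hmin⟩ := Finset.exists_min_image (Finset.Icc 2 (N + 2)) ρ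
      ⟨2, Finset.mem_Icc.2 ⟨le_rfl, by omega⟩⟩
    exact ⟨ρ m, hpos m (Finset.mem_Icc.1 hm).1, hmin⟩
  obtain ⟨κ, hκ, hκle⟩ := hsmall
  -- The last term is 1 + ρ ≤ exp(2β)(1 - ρ) solved for 1 - ρ.
  refine ⟨min (min κ (c / β)) (2 / (Real.exp (2 * β) + 1)), by positivity, fun n hn =>
    ⟨ρ n, (min_le_left _ _).trans ?_, (min_le_right _ _).trans ?_, hρ n⟩⟩
  · rcases le_total N n with h | h
    · exact (min_le_right _ _).trans (hlarge n hn h)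
    · exact (min_le_left _ _).trans (hκle n (Finset.mem_Icc.2 ⟨hn, by omega⟩))
  · have hij : (⟨0, by omega⟩ : Fin n) ≠ ⟨1, by omega⟩ := by simp
    have h1 := one_add_correlation_le hβ0 hij
    rw [hρ n _ _ hij] at h1
    rw [div_le_iff₀ (by positivity)]
    linarith

theorem mainTheorem12 (β : ℝ) (hβ : 1 < β) :
    ∃ c₁ c₂ : ℝ, 0 < c₁ ∧ 0 < c₂ ∧
      ∀ n : ℕ, 1 ≤ n → IsingRegular (curieWeiss n β) (c₁ / n) c₂ := by
  obtain ⟨κ, hκ, hcor⟩ := exists_correlation_bounds hβ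
  set K := √2 * Real.exp (1 / 2) with hK
  have hK1 : 1 ≤ K := one_le_mul_of_one_le_of_one_le
    (Real.one_le_sqrt.2 (by norm_num)) (Real.one_le_exp (by norm_num))
  -- The second moment is at least κW, so this c brings the exponent below (u·x)²/(8W).
  set c := κ / 8 with hc
  have hc0 : 0 < c := by positivity
  refine ⟨2 * c, 2 / c * Real.exp (1 / 4) * K * Real.exp ((1 + 2 * c) / 4), by positivity,
    by positivity, fun n hn => ?_⟩
  -- For n = 1 the zero diagonal forces J = J*; there are no pairs to correlate.
  rcases hn.eq_or_lt with rfl | hn2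
  · refine ⟨by positivity, by positivity, fun J hJ _ => ?_⟩
    have hJ0 : J - curieWeiss 1 β = 0 := by
      ext i j
      rw [Subsingleton.elim j i, Matrix.sub_apply, hJ.2 i,
        (curieWeiss_mem_zeroDiagSymm 1 β).2 i, sub_zero, Matrix.zero_apply]
    have h0 : sqNormMulSpin (J - curieWeiss 1 β) = fun _ => 0 := by
      ext x
      simp [hJ0, sqNormMulSpin]
    simp [h0, isingExpectation_const]
  obtain ⟨ρ, hρ0, hρ1, hρ⟩ := hcor n hn2
  refine isingRegular_of_exp_sq_le hn _ hc0 (by positivity) fun u => ?_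
  rw [isingExpectation_sq_dotProduct hρ]
  set W := ∑ i, u i ^ 2 + (∑ i, u i) ^ 2 with hW
  have hs : 0 ≤ ∑ i, u i ^ 2 := Finset.sum_nonneg fun i _ => sq_nonneg _
  have hW0 : 0 ≤ W := add_nonneg hs (sq_nonneg _)
  have hVW : κ * W ≤ (1 - ρ) * ∑ i, u i ^ 2 + ρ * (∑ i, u i) ^ 2 := by
    rw [hW, mul_add]
    gcongr
  rcases hW0.eq_or_lt with hz | hpos
  · have hu : u = 0 := by
      ext i
      have h1 : ∑ i, u i ^ 2 = 0 := by linarith [sq_nonneg (∑ i, u i)]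
      exact pow_eq_zero_iff two_ne_zero |>.1
        ((Finset.sum_eq_zero_iff_of_nonneg fun i _ => sq_nonneg _).1 h1 i (Finset.mem_univ i))
    simpa [hu, isingExpectation_const] using hK1
  · refine le_trans (isingExpectation_mono _ fun x => Real.exp_le_exp.2 ?_)
      (isingExpectation_exp_sq_le (by linarith) hn u hpos)
    calc c * ((u ⬝ᵥ x.toVec) ^ 2 / ((1 - ρ) * ∑ i, u i ^ 2 + ρ * (∑ i, u i) ^ 2))
        ≤ c * ((u ⬝ᵥ x.toVec) ^ 2 / (κ * W)) := by gcongr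
      _ = 1 / 8 * ((u ⬝ᵥ x.toVec) ^ 2 / W) := by rw [hc]; field_simp
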